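/- Let $G$ be a hypothesised probability distribution on $\mathbb R$ with a density (its CDF is also denoted $G$), and let $h_0=1,h_1,h_2,\dots$ be square-integrable orthonormal functions on $[0,1]$ with respect to Lebesgue measure (for instance an orthonormal basis of $L^2[0,1]$). Let $X_1,X_2,\dots$ be i.i.d. with distribution $F$, which has a density, and let $M\ge 1$ be fixed. From the first $n$ observations form the coefficients $\widehat\theta_j=\frac1n\sum_{i=1}^n h_j(G(X_i))$, $j=1,\dots,M$, and order their squares as $\widehat\theta^2_{(1)}\ge\dots\ge\widehat\theta^2_{(M)}$. Let $m$ be the largest maximiser of $$\mathrm{BIC}(m)=\sum_{j=1}^m\widehat\theta_{(j)}^2-\frac{m\log n}{n}$$ over $m\in\{1,\dots,M\}$ (or over $m\in\{0,1,\dots,M\}$: the result holds in both cases), and let $K_{(m)}=\max_{1\le j\le m} n\,\widehat\theta_{(j)}^2$ be the post-selection K-statistic, with $K_{(0)}=0$. Put $p_{\mathrm{adj}}(k)=1-P(\chi^2_1\le k)^M$, where $\chi^2_1$ is chi-squared with one degree of freedom. Then, under $H_0: F=G$, for every real $k$ the limit $\lim_{n\to\infty}P(K_{(m)}\ge k\mid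 H_0)$ exists and $$\lim_{n\to\infty}P\bigl(K_{(m)}\ge k\mid H_0\bigr)\le p_{\mathrm{adj}}(k)=1-P(\chi^2_1\le k)^M .$$ Moreover, $p_{\mathrm{adj}}(K_{(m)})$ is an asymptotically conservative post-selection p-value: for every $\alpha\in[0,1]$, the limit $\lim_{n\to\infty}P\bigl(p_{\mathrm{adj}}(K_{(m)})\le\alpha\mid H_0\bigr)$ exists and is at most $\alpha$. -/

import Mathlib

open MeasureTheory ProbabilityTheory Filter Topology

noncomputable section

namespace SmoothTest

/-- A family of functions on `[0, 1]`, square integrable and orthonormal for Lebesgue measure on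
`[0, 1]`, whose first member is the constant `1`. -/
structure IsOrthonormalSystem (h : ℕ → ℝ → ℝ) : Prop where
  memLp : ∀ j, MemLp (h j) 2 (volume.restrict (Set.Icc (0 : ℝ) 1))
  orthonormal : ∀ i j, ∫ u in Set.Icc (0 : ℝ) 1, h i u * h j u = if i = j then 1 else 0
  zero_eq_one : ∀ u ∈ Set.Icc (0 : ℝ) 1, h 0 u = 1

/-- The estimated coefficient `θ̂ⱼ = (1/n) ∑ᵢ hⱼ(G(xᵢ))`, where `G` is the hypothesised
distribution and the sample of size `n` is `x 0, …, x (n - 1)`. -/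
def coefHat (h : ℕ → ℝ → ℝ) (G : Measure ℝ) (n : ℕ) (x : ℕ → ℝ) (j : ℕ) : ℝ :=
  (1 / (n : ℝ)) * ∑ i ∈ Finset.range n, h j (cdf G (x i))

/-- The squared coefficients `θ̂₁², …, θ̂_M²`; position `j : Fin M` holds `θ̂_{j+1}²`. -/
def coefHatSq (h : ℕ → ℝ → ℝ) (G : Measure ℝ) (M n : ℕ) (x : ℕ → ℝ) (j : Fin M) : ℝ :=
  coefHat h G n x ((j : ℕ) + 1) ^ 2

/-- The decreasing rearrangement of `v`: position `j : Fin M` holds the `(j+1)`-st largest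
entry, counted with multiplicity. -/
def decreasing {M : ℕ} (v : Fin M → ℝ) (j : Fin M) : ℝ :=
  v (Tuple.sort (fun i => -v i) j)

theorem decreasing_antitone {M : ℕ} (v : Fin M → ℝ) : Antitone (decreasing v) := by
  intro i j hij
  have := Tuple.monotone_sort (fun i => -v i) hij
  simpa [decreasing] using this

/-- `BIC(m)`: the sum of the `m` largest entries of `v`, minus `m log n / n`. -/
def bic {M : ℕ} (n : ℕ) (v : Fin M → ℝ) (m : ℕ) : ℝ :=
  (∑ j ∈ Finset.univ.filter (fun j : Fin M => (j : ℕ) < m), decreasing v j) - (m : ℝ) * Real.log n / n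

/-- The `m` in `{m₀, …, M}` whose BIC is maximal among these. -/
def bicMaximizers {M : ℕ} (m₀ n : ℕ) (v : Fin M → ℝ) : Set ℕ :=
  {m | m ∈ Set.Icc m₀ M ∧ ∀ m' ∈ Set.Icc m₀ M, bic n v m' ≤ bic n v m}

/-- The model size selected by BIC: the largest maximizer over `{m₀, …, M}`. -/
def selected {M : ℕ} (m₀ n : ℕ) (v : Fin M → ℝ) : ℕ :=
  sSup (bicMaximizers m₀ n v)

theorem isGreatest_selected {M : ℕ} (m₀ n : ℕ) (hM : m₀ ≤ M) (v : Fin M → ℝ) :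
    IsGreatest (bicMaximizers m₀ n v) (selected m₀ n v) := by
  have hb : BddAbove (bicMaximizers m₀ n v) := ⟨M, fun m hm => hm.1.2⟩
  have hne : (bicMaximizers m₀ n v).Nonempty := by
    obtain ⟨m, hm, hmax⟩ := (Set.finite_Icc m₀ M).exists_maximalFor (bic n v) _
      ⟨m₀, Set.left_mem_Icc.2 hM⟩
    exact ⟨m, hm, fun m' hm' => (le_total (bic n v m') (bic n v m)).elim id (hmax hm')⟩
  exact ⟨Nat.sSup_mem hne hb, fun m hm => le_csSup hb hm⟩

open Classical in
/-- The maximum of `n` times the `m` largest entries of `v`; it is `0` if there are none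
(`m = 0`). -/
def maxTop {M : ℕ} (n : ℕ) (v : Fin M → ℝ) (m : ℕ) : ℝ :=
  if hm : (Finset.univ.filter fun j : Fin M => (j : ℕ) < m).Nonempty then
    (Finset.univ.filter fun j : Fin M => (j : ℕ) < m).sup' hm
      fun j => (n : ℝ) * decreasing v j
  else 0

/-- The post-selection K-statistic `K₍ₘ₎ = max_{j ≤ m} n θ̂²₍ⱼ₎`, where `m` is the size selected
by BIC among `{m₀, …, M}`. -/
def kStat (h : ℕ → ℝ → ℝ) (G : Measure ℝ) (m₀ M n : ℕ) (x : ℕ → ℝ) : ℝ :=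
  maxTop n (coefHatSq h G M n x) (selected m₀ n (coefHatSq h G M n x))

/-- The chi-squared distribution with one degree of freedom: the law of the square of a standard
normal variable. -/
def chiSqOne : Measure ℝ := (gaussianReal 0 1).map fun z => z ^ 2

/-- The adjusted p-value `1 - P(χ²₁ ≤ k)^M`. -/
def adjPValue (M : ℕ) (k : ℝ) : ℝ := 1 - chiSqOne.real (Set.Iic k) ^ M

end SmoothTest

end

/-!
# Asymptotic law of the post-selection K-statistic

Under the null hypothesis the variables `G(Xᵢ)` are independent and uniform on `[0, 1]`
(`SmoothTest.map_cdf_eq_volume_restrict`). The functions `h₁, …, h_M` are centred, being orthogonal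
to `h₀ = 1`, and orthonormal, so the vector of the `√n θ̂ⱼ` converges in distribution to a standard
Gaussian vector (`SmoothTest.tendstoInDistribution_orthonormal_sum`). Hence the probability that
`max_j n θ̂ⱼ²` is at least `k` tends to the probability that the maximum of `M` independent `χ²₁`
variables is, which is `p_adj(k)` (`SmoothTest.tendsto_measureReal_exists_le_sq`).

The squared coefficients are ordered decreasingly, so every nonempty model contains the largest one
and gives the same K-statistic `max_j n θ̂ⱼ²` (`SmoothTest.le_maxTop_iff`). If the empty model is
excluded, the limit is therefore exactly `p_adj(k)`. If it is admitted, it is selected unless some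
`n θ̂ⱼ²` reaches the penalty `log n` (`SmoothTest.selected_eq_zero`), an event whose probability
tends to `0`; the K-statistic then tends to `0` in probability, and the limit is `0` for `k > 0` and
`1 = p_adj(k)` for `k ≤ 0`.

The second assertion follows from the first, because the sublevel sets of `p_adj` are closed upper
sets of `ℝ` (`SmoothTest.setOf_adjPValue_le`).
-/

namespace SmoothTest

/-! ### The probability integral transform -/

/-- The probability integral transform: if `X` has a law `G` without atoms, then `G(X)` is uniform
on `[0, 1]`. For `0 < u < 1` the set `{cdf G ≤ u}` is a closed half-line `(-∞, s]` with `cdf G s =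
u`. -/
theorem map_cdf_eq_volume_restrict (G : Measure ℝ) [IsProbabilityMeasure G] [NullSingletonClass G] :
    G.map (cdf G) = volume.restrict (Set.Icc (0 : ℝ) 1) := by
  have hmeas : Measurable (cdf G) := (monotone_cdf G).measurable
  have : IsProbabilityMeasure (G.map (cdf G)) := Measure.isProbabilityMeasure_map hmeas.aemeasurable
  have hcont : Continuous (cdf G) := by
    refine continuous_iff_continuousAt.2 fun x =>
      (cdf G).mono.continuousAt_iff_leftLim_eq_rightLim.2 ?_
    have h0 : ENNReal.ofReal (cdf G x - Function.leftLim (cdf G) x) = 0 := by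
      rw [← StieltjesFunction.measure_singleton, measure_cdf, measure_singleton]
    rw [StieltjesFunction.rightLim_eq]
    exact le_antisymm ((cdf G).mono.leftLim_le le_rfl) (by simpa using h0)
  refine Measure.ext_of_Iic _ _ fun u => ?_
  rw [Measure.map_apply hmeas measurableSet_Iic, Measure.restrict_apply measurableSet_Iic]
  rcases lt_or_ge u 0 with hu | hu
  · have h1 : cdf G ⁻¹' Set.Iic u = ∅ := by
      ext x; simpa using hu.trans_le (cdf_nonneg G x)
    have h2 : Set.Iic u ∩ Set.Icc (0 : ℝ) 1 = ∅ := by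
      ext x; simp only [Set.mem_inter_iff, Set.mem_Iic, Set.mem_Icc, Set.mem_empty_iff_false]
      refine iff_false_intro fun h => ?_
      linarith [h.1, h.2.1]
    rw [h1, h2]; simp
  rcases le_or_gt 1 u with hu1 | hu1
  · have h1 : cdf G ⁻¹' Set.Iic u = Set.univ := by
      ext x; simpa using (cdf_le_one G x).trans hu1
    have h2 : Set.Iic u ∩ Set.Icc (0 : ℝ) 1 = Set.Icc 0 1 :=
      Set.inter_eq_right.2 fun x hx => hx.2.trans hu1
    rw [h1, h2]; simp
  have h2 : Set.Iic u ∩ Set.Icc (0 : ℝ) 1 = Set.Icc 0 u := by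
    ext x; simp only [Set.mem_inter_iff, Set.mem_Iic, Set.mem_Icc]
    exact ⟨fun h => ⟨h.2.1, h.1⟩, fun h => ⟨h.2, h.1, h.2.trans hu1.le⟩⟩
  rw [h2, Real.volume_Icc, sub_zero]
  set T := cdf G ⁻¹' Set.Iic u
  have hclosed : IsClosed T := isClosed_Iic.preimage hcont
  have hbdd : BddAbove T := by
    obtain ⟨b, hb⟩ := ((tendsto_cdf_atTop G).eventually (lt_mem_nhds hu1)).exists
    exact ⟨b, fun x hx => le_of_lt ((cdf G).mono.reflect_lt (lt_of_le_of_lt hx hb))⟩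
  rcases hu.eq_or_lt with rfl | hu0
  · -- `0` need not be a value of `cdf G`, so `T` may be empty; otherwise `cdf G` still vanishes at
    -- `sSup T`, because `T` is closed
    rcases T.eq_empty_or_nonempty with h | h
    · simp [h]
    · have hs : sSup T ∈ T := hclosed.csSup_mem h hbdd
      have hTs : T ⊆ Set.Iic (sSup T) := fun x hx => le_csSup hbdd hx
      refine le_antisymm ((measure_mono hTs).trans ?_) (by simp)
      rw [← ofReal_cdf]
      exact ENNReal.ofReal_le_ofReal hs
  · obtain ⟨a, ha⟩ := ((tendsto_cdf_atBot G).eventually (gt_mem_nhds hu0)).exists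
    obtain ⟨b, hb⟩ := ((tendsto_cdf_atTop G).eventually (lt_mem_nhds hu1)).exists
    obtain ⟨x, hx⟩ := mem_range_of_exists_le_of_exists_ge hcont ⟨a, ha.le⟩ ⟨b, hb.le⟩
    have hxT : x ∈ T := hx.le
    have hs : sSup T ∈ T := hclosed.csSup_mem ⟨x, hxT⟩ hbdd
    have hTs : T = Set.Iic (sSup T) := Set.Subset.antisymm (fun y hy => le_csSup hbdd hy)
      fun y hy => ((cdf G).mono hy).trans hs
    rw [hTs, ← ofReal_cdf]
    congr 1
    exact le_antisymm hs (hx ▸ (cdf G).mono (le_csSup hbdd hxT))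

/-! ### The chi-squared law and the adjusted p-value -/

instance : IsProbabilityMeasure chiSqOne :=
  Measure.isProbabilityMeasure_map (by fun_prop)

theorem chiSqOne_apply {s : Set ℝ} (hs : MeasurableSet s) :
    chiSqOne s = gaussianReal 0 1 ((fun z => z ^ 2) ⁻¹' s) :=
  Measure.map_apply (by fun_prop) hs

theorem gaussianReal_sq_eq (k : ℝ) : gaussianReal 0 1 {z : ℝ | z ^ 2 = k} = 0 := by
  have : NullSingletonClass (gaussianReal 0 1) := nullSingletonClass_gaussianReal one_ne_zero
  refine (Set.Finite.subset (Set.toFinite {√k, -√k}) fun z hz => ?_).measure_zero _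
  have hz : z ^ 2 = k := hz
  rcases le_total 0 z with h | h
  · left; rw [← hz, Real.sqrt_sq h]
  · right; simp [← hz, Real.sqrt_sq_eq_abs, abs_of_nonpos h]

theorem adjPValue_eq (M : ℕ) (k : ℝ) : adjPValue M k = 1 - cdf chiSqOne k ^ M := by
  rw [adjPValue, cdf_eq_real]

theorem adjPValue_antitone (M : ℕ) : Antitone (adjPValue M) := by
  intro a b hab
  rw [adjPValue_eq, adjPValue_eq]
  have := pow_le_pow_left₀ (cdf_nonneg chiSqOne a) (monotone_cdf chiSqOne hab) M
  linarith

theorem adjPValue_nonneg (M : ℕ) (k : ℝ) : 0 ≤ adjPValue M k := by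
  rw [adjPValue_eq]
  linarith [pow_le_one₀ (n := M) (cdf_nonneg chiSqOne k) (cdf_le_one chiSqOne k)]

theorem adjPValue_of_nonpos {M : ℕ} (hM : 1 ≤ M) {k : ℝ} (hk : k ≤ 0) : adjPValue M k = 1 := by
  have h0 : chiSqOne (Set.Iic k) = 0 := by
    rw [chiSqOne_apply measurableSet_Iic]
    refine measure_mono_null (fun z hz => ?_) (gaussianReal_sq_eq 0)
    exact le_antisymm (le_trans hz hk) (sq_nonneg z)
  have hM0 : M ≠ 0 := by omega
  simp [adjPValue, measureReal_def, h0, hM0]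

theorem tendsto_adjPValue_atTop (M : ℕ) : Tendsto (adjPValue M) atTop (𝓝 0) := by
  have := ((tendsto_cdf_atTop chiSqOne).pow M).const_sub 1
  simp only [one_pow, sub_self] at this
  exact this.congr fun k => (adjPValue_eq M k).symm

/-- The sublevel sets of `adjPValue M` are closed upper sets of `ℝ`, because `adjPValue M` is
antitone and right-continuous. Hence `p_adj(K) ≤ α` is always an event of the form `q ≤ K`, up to
the two degenerate cases. -/
theorem setOf_adjPValue_le (M : ℕ) (α : ℝ) :
    {k | adjPValue M k ≤ α} = ∅ ∨ {k | adjPValue M k ≤ α} = Set.univ ∨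
      ∃ q, adjPValue M q ≤ α ∧ {k | adjPValue M k ≤ α} = Set.Ici q := by
  set S := {k | adjPValue M k ≤ α}
  have hup : ∀ {a b}, a ∈ S → a ≤ b → b ∈ S := fun ha hab => (adjPValue_antitone M hab).trans ha
  rcases S.eq_empty_or_nonempty with h | hne
  · exact .inl h
  by_cases hb : BddBelow S
  · refine .inr (.inr ⟨sInf S, ?_⟩)
    have hq : sInf S ∈ S := by
      have hc : Tendsto (adjPValue M) (𝓝[>] (sInf S)) (𝓝 (adjPValue M (sInf S))) := by
        simp_rw [funext (adjPValue_eq M)]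
        exact ((((cdf chiSqOne).right_continuous (sInf S)).mono Set.Ioi_subset_Ici_self).pow
          M).const_sub 1
      refine le_of_tendsto hc ?_
      filter_upwards [self_mem_nhdsWithin] with k hk
      obtain ⟨a, ha, hak⟩ := exists_lt_of_csInf_lt hne hk
      exact hup ha hak.le
    exact ⟨hq, Set.Subset.antisymm (fun k hk => csInf_le hb hk) fun k hk => hup hq hk⟩
  · refine .inr (.inl (Set.eq_univ_of_forall fun k => ?_))
    obtain ⟨a, ha, hak⟩ := not_bddBelow_iff.1 hb k
    exact hup ha hak.le

/-! ### The selected model -/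

section Selection

variable {M : ℕ}

theorem exists_decreasing_eq (v : Fin M → ℝ) (j : Fin M) : ∃ i, decreasing v i = v j :=
  ⟨(Tuple.sort fun i => -v i).symm j, by simp [decreasing]⟩

/-- Since the entries are taken in decreasing order, the maximum over a nonempty selected model is
the maximum over all entries: once `1 ≤ m`, the value of `m` is irrelevant. -/
theorem le_maxTop_iff (n : ℕ) (v : Fin M → ℝ) {m : ℕ} (hM : 1 ≤ M) (hm : 1 ≤ m) (k : ℝ) :
    k ≤ maxTop n v m ↔ ∃ j, k ≤ n * v j := by
  have hne : (Finset.univ.filter fun j : Fin M => (j : ℕ) < m).Nonempty :=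
    ⟨⟨0, hM⟩, by simp; omega⟩
  rw [maxTop, dif_pos hne, Finset.le_sup'_iff]
  constructor
  · rintro ⟨j, -, hj⟩
    exact ⟨_, hj⟩
  · rintro ⟨j, hj⟩
    obtain ⟨i, hi⟩ := exists_decreasing_eq v j
    refine ⟨⟨0, hM⟩, by simp; omega, hj.trans ?_⟩
    rw [← hi]
    exact mul_le_mul_of_nonneg_left (decreasing_antitone v (Nat.zero_le _)) n.cast_nonneg

theorem maxTop_zero (n : ℕ) (v : Fin M → ℝ) : maxTop n v 0 = 0 := by
  simp [maxTop]

theorem maxTop_nonneg (n : ℕ) {v : Fin M → ℝ} (hv : ∀ j, 0 ≤ v j) (m : ℕ) : 0 ≤ maxTop n v m := by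
  unfold maxTop
  split_ifs with hm
  · obtain ⟨j, hj⟩ := id hm
    exact (mul_nonneg n.cast_nonneg (hv _)).trans
      (Finset.le_sup' (fun j => (n : ℝ) * decreasing v j) hj)
  · exact le_rfl

/-- If every `n * v j` is below the BIC penalty `log n`, then adding components to the empty model
strictly decreases BIC, so the empty model is selected. -/
theorem selected_eq_zero {n : ℕ} (hn : 1 ≤ n) {v : Fin M → ℝ}
    (hv : ∀ j, n * v j < Real.log n) : selected 0 n v = 0 := by
  obtain ⟨⟨⟨-, hsM⟩, hmax⟩, -⟩ := isGreatest_selected 0 n (Nat.zero_le M) v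
  set s := selected 0 n v
  by_contra hs
  have hn' : (0 : ℝ) < n := by exact_mod_cast hn
  have hcard : (Finset.univ.filter fun j : Fin M => (j : ℕ) < s).card = s := by
    rw [Fin.card_filter_val_lt, min_eq_right hsM]
  have hne : (Finset.univ.filter fun j : Fin M => (j : ℕ) < s).Nonempty := by
    rw [← Finset.card_pos]; omega
  have hlt : ∑ j ∈ Finset.univ.filter (fun j : Fin M => (j : ℕ) < s), decreasing v j <
      ∑ j ∈ Finset.univ.filter (fun j : Fin M => (j : ℕ) < s), Real.log n / n :=
    Finset.sum_lt_sum_of_nonempty hne fun j _ => (lt_div_iff₀' hn').2 (hv _)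
  rw [Finset.sum_const, hcard, nsmul_eq_mul, ← mul_div_assoc] at hlt
  have h0 : bic n v 0 = 0 := by simp [bic]
  have := hmax 0 ⟨le_rfl, Nat.zero_le M⟩
  rw [h0, bic] at this
  linarith

theorem natCast_mul_coefHatSq (h : ℕ → ℝ → ℝ) (G : Measure ℝ) (n : ℕ) (x : ℕ → ℝ) (j : Fin M) :
    n * coefHatSq h G M n x j =
      ((√n)⁻¹ * ∑ i ∈ Finset.range n, h (j + 1) (cdf G (x i))) ^ 2 := by
  rw [coefHatSq, coefHat, mul_pow, mul_pow, inv_pow, Real.sq_sqrt n.cast_nonneg]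
  rcases eq_or_ne (n : ℝ) 0 with hn | hn
  -- for `n = 0` both sides vanish
  · simp [hn]
  · field_simp

theorem kStat_nonneg (h : ℕ → ℝ → ℝ) (G : Measure ℝ) (m₀ M n : ℕ) (x : ℕ → ℝ) :
    0 ≤ kStat h G m₀ M n x :=
  maxTop_nonneg n (fun _ => sq_nonneg _) _

theorem le_kStat_one_iff (h : ℕ → ℝ → ℝ) (G : Measure ℝ) (hM : 1 ≤ M) (n : ℕ) (x : ℕ → ℝ) (k : ℝ) :
    k ≤ kStat h G 1 M n x ↔
      ∃ j : Fin M, k ≤ ((√n)⁻¹ * ∑ i ∈ Finset.range n, h (j + 1) (cdf G (x i))) ^ 2 := by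
  simp_rw [← natCast_mul_coefHatSq]
  exact le_maxTop_iff n _ hM (isGreatest_selected 1 n hM _).1.1.1 k

/-- When the empty model is admitted, a positive K-statistic forces some normalized squared
coefficient to reach the penalty `log n`. -/
theorem exists_log_le_of_pos_kStat_zero (h : ℕ → ℝ → ℝ) (G : Measure ℝ) {n : ℕ} (hn : 1 ≤ n)
    (x : ℕ → ℝ) (hk : 0 < kStat h G 0 M n x) :
      ∃ j : Fin M, Real.log n ≤ ((√n)⁻¹ * ∑ i ∈ Finset.range n, h (j + 1) (cdf G (x i))) ^ 2 := by
  by_contra! hlt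
  simp_rw [← natCast_mul_coefHatSq] at hlt
  rw [kStat, selected_eq_zero hn hlt, maxTop_zero] at hk
  exact hk.false

end Selection

/-! ### The multivariate central limit theorem for orthonormal functions -/

section Limit

variable {Ω : Type*} [MeasurableSpace Ω] {P : Measure Ω} [IsProbabilityMeasure P]
  {E : Type*} [MeasurableSpace E] {ν : Measure E} {ι : Type*} [Fintype ι]

/-- Parseval's identity for finite combinations of orthonormal functions. -/
theorem integral_sum_mul_orthonormal {f : ι → E → ℝ} [DecidableEq ι]
    (hf : ∀ j, MemLp (f j) 2 ν) (horth : ∀ i j, ∫ u, f i u * f j u ∂ν = if i = j then 1 else 0)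
    (t : ι → ℝ) : ∫ u, (∑ j, t j * f j u) ^ 2 ∂ν = ∑ j, t j ^ 2 := by
  have hint : ∀ i j, Integrable (fun u => f i u * f j u) ν := fun i j =>
    (hf i).integrable_mul (hf j)
  have h1 : ∀ u, (∑ j, t j * f j u) ^ 2 = ∑ i, ∑ j, t i * t j * (f i u * f j u) := by
    intro u
    rw [sq, Finset.sum_mul_sum]
    exact Finset.sum_congr rfl fun i _ => Finset.sum_congr rfl fun j _ => by ring
  simp_rw [h1]
  rw [integral_finsetSum _ fun i _ => integrable_finsetSum _ fun j _ => (hint i j).const_mul _]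
  refine Finset.sum_congr rfl fun i _ => ?_
  rw [integral_finsetSum _ fun j _ => (hint i j).const_mul _]
  simp_rw [integral_const_mul, horth]
  simp [sq]

/-- The central limit theorem for the vector of normalized empirical coefficients of centred
orthonormal functions: the limit is standard Gaussian. By the Cramér–Wold device, it follows from
the one-dimensional theorem applied to `∑ j, t j * f j`, whose variance is `‖t‖ ^ 2`. -/
theorem tendstoInDistribution_orthonormal_sum [IsProbabilityMeasure ν] {U : ℕ → Ω → E}
    (hU : ∀ i, HasLaw (U i) ν P) (hindep : iIndepFun U P) [DecidableEq ι] {f : ι → E → ℝ}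
    (hf : ∀ j, MemLp (f j) 2 ν) (hmean : ∀ j, ∫ u, f j u ∂ν = 0)
    (horth : ∀ i j, ∫ u, f i u * f j u ∂ν = if i = j then 1 else 0) :
    TendstoInDistribution (fun (n : ℕ) ω => WithLp.toLp 2 fun j : ι =>
      (√n)⁻¹ * ∑ i ∈ Finset.range n, f j (U i ω)) atTop
      (id : EuclideanSpace ℝ ι → EuclideanSpace ℝ ι) (fun _ => P) (stdGaussian _) := by
  have hUm : ∀ i, AEMeasurable (U i) P := fun i => (hU i).aemeasurable
  have hfm : ∀ j i, AEMeasurable (f j) (P.map (U i)) := fun j i => by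
    rw [(hU i).map_eq]; exact (hf j).1.aemeasurable
  have hfU : ∀ j i, AEMeasurable (fun ω => f j (U i ω)) P := fun j i =>
    (hfm j i).comp_aemeasurable (hUm i)
  have hS : ∀ n : ℕ, AEMeasurable (fun ω => WithLp.toLp 2 fun j : ι =>
      (√n)⁻¹ * ∑ i ∈ Finset.range n, f j (U i ω)) P := fun n => by
    refine (WithLp.measurable_toLp 2 _).comp_aemeasurable (aemeasurable_pi_iff.2 fun j => ?_)
    exact (Finset.aemeasurable_fun_sum _ fun i _ => hfU j i).const_mul _
  refine ⟨hS, by fun_prop, ProbabilityMeasure.tendsto_of_tendsto_charFun fun t => ?_⟩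
  set g : E → ℝ := fun u => ∑ j, t j * f j u with hg
  have hgL : MemLp g 2 ν := memLp_finsetSum _ fun j _ => (hf j).const_mul _
  have hgm : ∀ i, AEMeasurable g (P.map (U i)) := fun i => by
    rw [(hU i).map_eq]; exact hgL.1.aemeasurable
  have hident : ∀ i, IdentDistrib (g ∘ U i) (g ∘ U 0) P P := fun i =>
    ((hU i).identDistrib (hU 0)).comp_of_aemeasurable (hgm i)
  have hg0 : P[g ∘ U 0] = 0 := by
    have : ∫ u, g u ∂ν = 0 := by
      rw [hg, integral_finsetSum _ fun j _ => ((hf j).integrable one_le_two).const_mul _]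
      simp [integral_const_mul, hmean]
    rw [← this, ← (hU 0).map_eq, integral_map (hUm 0) (hgm 0).aestronglyMeasurable]
    rfl
  have hgV : Var[g ∘ U 0; P] = ‖t‖ ^ 2 := by
    rw [variance_of_integral_eq_zero ((hgm 0).comp_aemeasurable (hUm 0)) hg0,
      EuclideanSpace.real_norm_sq_eq, ← integral_sum_mul_orthonormal hf horth t,
      ← (hU 0).map_eq, integral_map (hUm 0) ((hgm 0).pow_const 2).aestronglyMeasurable]
    rfl
  have hgP : MemLp (g ∘ U 0) 2 P :=
    (memLp_map_measure_iff (hgm 0).aestronglyMeasurable (hUm 0)).1 (by rwa [(hU 0).map_eq])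
  have hclt := tendstoInDistribution_inv_sqrt_mul_sum_sub (X := fun i => g ∘ U i) (P := P)
    (Y := id) (P' := gaussianReal 0 Var[g ∘ U 0; P].toNNReal) ⟨by fun_prop, by simp⟩
    hgP (hindep.comp₀ (fun _ => g) hUm hgm) hident
  have h1 := ProbabilityMeasure.tendsto_iff_tendsto_charFun.1 hclt.tendsto 1
  simp only [ProbabilityMeasure.coe_mk, Measure.map_id] at h1 ⊢
  rw [charFun_stdGaussian]
  rw [charFun_gaussianReal, hgV, Real.coe_toNNReal _ (sq_nonneg _)] at h1
  convert! h1.congr fun n => ?_ using 2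
  · simp [neg_div]
  · have hY := hclt.forall_aemeasurable n
    rw [charFun_apply, charFun_apply, integral_map (hS n) (by fun_prop),
      integral_map hY (by fun_prop)]
    refine integral_congr_ae (.of_forall fun ω => ?_)
    have : (√(n : ℝ))⁻¹ * (∑ i ∈ Finset.range n, (g ∘ U i) ω - n * P[g ∘ U 0]) =
        inner ℝ (WithLp.toLp 2 fun j : ι =>
          (√(n : ℝ))⁻¹ * ∑ i ∈ Finset.range n, f j (U i ω)) t := by
      rw [hg0, mul_zero, sub_zero]
      simp only [Function.comp_apply, hg, PiLp.inner_apply, RCLike.inner_apply,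
        conj_trivial, Finset.mul_sum]
      rw [Finset.sum_comm]
      exact Finset.sum_congr rfl fun j _ => Finset.sum_congr rfl fun i _ => by ring
    simp only [this]
    simp

/-! ### The largest squared coordinate of a Gaussian vector -/

theorem measurableSet_exists_le_sq (M : ℕ) (k : ℝ) :
    MeasurableSet {v : EuclideanSpace ℝ (Fin M) | ∃ j, k ≤ v j ^ 2} := by
  simp only [Set.ofPred_exists]
  exact .iUnion fun j => measurableSet_le measurable_const (by fun_prop)

/-- The largest of `M` independent `χ²₁` variables is at least `k` with probability exactly
`adjPValue M k`; in the complementary event `< k` may be replaced by `≤ k`, because `χ²₁` has no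
atoms. -/
theorem stdGaussian_real_exists_le_sq (M : ℕ) (k : ℝ) :
    (stdGaussian (EuclideanSpace ℝ (Fin M))).real {v | ∃ j, k ≤ v j ^ 2} = adjPValue M k := by
  have hm := measurableSet_exists_le_sq M k
  have hlt : gaussianReal 0 1 {z : ℝ | z ^ 2 < k} = chiSqOne (Set.Iic k) := by
    rw [chiSqOne_apply measurableSet_Iic]
    refine le_antisymm (measure_mono fun z (hz : z ^ 2 < k) => hz.le) ?_
    refine (measure_mono fun z (hz : z ^ 2 ≤ k) => hz.lt_or_eq).trans
      ((measure_union_le {z : ℝ | z ^ 2 < k} {z | z ^ 2 = k}).trans ?_)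
    rw [gaussianReal_sq_eq, add_zero]
  rw [← compl_compl {v : EuclideanSpace ℝ (Fin M) | ∃ j, k ≤ v j ^ 2}, probReal_compl_eq_one_sub
    hm.compl, adjPValue, ← map_pi_eq_stdGaussian, measureReal_def, measureReal_def,
    Measure.map_apply (by fun_prop) hm.compl]
  have : (WithLp.toLp 2 ⁻¹' {v : EuclideanSpace ℝ (Fin M) | ∃ j, k ≤ v j ^ 2}ᶜ) =
      Set.univ.pi fun _ : Fin M => {z : ℝ | z ^ 2 < k} := by
    ext v; simp
  rw [this, Measure.pi_pi, Finset.prod_const, hlt, ENNReal.toReal_pow]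
  simp

/-- The boundary lies in the union of the sets `{v | v j ^ 2 = k}`, so the portmanteau theorem
applies to `{v | ∃ j, k ≤ v j ^ 2}`. -/
theorem stdGaussian_frontier_exists_le_sq (M : ℕ) (k : ℝ) :
    stdGaussian (EuclideanSpace ℝ (Fin M)) (frontier {v | ∃ j, k ≤ v j ^ 2}) = 0 := by
  have hsub : frontier {v : EuclideanSpace ℝ (Fin M) | ∃ j, k ≤ v j ^ 2} ⊆
      ⋃ j, {v | v j ^ 2 = k} := by
    have hc : IsClosed {v : EuclideanSpace ℝ (Fin M) | ∃ j, k ≤ v j ^ 2} := by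
      simp only [Set.ofPred_exists]
      exact isClosed_iUnion_of_finite fun j => isClosed_le continuous_const (by fun_prop)
    have ho : IsOpen {v : EuclideanSpace ℝ (Fin M) | ∃ j, k < v j ^ 2} := by
      simp only [Set.ofPred_exists]
      exact isOpen_iUnion fun j => isOpen_lt continuous_const (by fun_prop)
    rw [hc.frontier_eq]
    rintro v ⟨⟨j, hj⟩, hv⟩
    have hsub : {v : EuclideanSpace ℝ (Fin M) | ∃ j, k < v j ^ 2} ⊆ {v | ∃ j, k ≤ v j ^ 2} := by
      rintro w ⟨i, hi⟩
      exact ⟨i, hi.le⟩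
    refine Set.mem_iUnion.2 ⟨j, le_antisymm (not_lt.1 fun h => hv ?_) hj⟩
    exact interior_maximal hsub ho ⟨j, h⟩
  refine measure_mono_null hsub (measure_iUnion_null fun j => ?_)
  have hm : MeasurableSet {z : ℝ | z ^ 2 = k} :=
    measurableSet_eq_fun (by fun_prop) measurable_const
  have hm' : MeasurableSet {v : EuclideanSpace ℝ (Fin M) | v j ^ 2 = k} :=
    measurableSet_eq_fun (by fun_prop) measurable_const
  rw [← map_pi_eq_stdGaussian, Measure.map_apply (by fun_prop) hm']
  exact (measurePreserving_eval (fun _ : Fin M => gaussianReal 0 1) j).measure_preimage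
    hm.nullMeasurableSet |>.trans (gaussianReal_sq_eq k)

theorem tendsto_measureReal_exists_le_sq {M : ℕ} {S : ℕ → Ω → EuclideanSpace ℝ (Fin M)}
    (hS : TendstoInDistribution S atTop
      (id : EuclideanSpace ℝ (Fin M) → EuclideanSpace ℝ (Fin M)) (fun _ => P) (stdGaussian _))
    (k : ℝ) :
    Tendsto (fun n => P.real {ω | ∃ j, k ≤ S n ω j ^ 2}) atTop (𝓝 (adjPValue M k)) := by
  have hm := measurableSet_exists_le_sq M k
  have := ProbabilityMeasure.tendsto_measure_of_null_frontier_of_tendsto' hS.tendsto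
    (E := {v | ∃ j, k ≤ v j ^ 2})
    (by simpa using stdGaussian_frontier_exists_le_sq M k)
  simp only [ProbabilityMeasure.coe_mk, Measure.map_id] at this
  rw [← stdGaussian_real_exists_le_sq]
  refine ((ENNReal.tendsto_toReal (measure_ne_top _ _)).comp this).congr fun n => ?_
  rw [Function.comp_apply, Measure.map_apply_of_aemeasurable (hS.forall_aemeasurable n) hm]
  rfl

/-! ### From the tail bound to the p-value -/

/-- If the tails of `K n` converge to limits at most `adjPValue M`, then `adjPValue M (K n)` is an
asymptotically conservative p-value. Outside the degenerate cases the sublevel set of `adjPValue M`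
at `α` is `{k | q ≤ k}` with `adjPValue M q ≤ α`, so the bound is the one on the tail at `q`; no
strict monotonicity or invertibility of `adjPValue M` is needed. -/
theorem exists_tendsto_adjPValue_le {M : ℕ} (hM : 1 ≤ M) {K : ℕ → Ω → ℝ}
    (hK : ∀ k, ∃ L, Tendsto (fun n => P.real {ω | k ≤ K n ω}) atTop (𝓝 L) ∧ L ≤ adjPValue M k)
    {α : ℝ} (hα : 0 ≤ α) :
    ∃ L, Tendsto (fun n => P.real {ω | adjPValue M (K n ω) ≤ α}) atTop (𝓝 L) ∧ L ≤ α := by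
  have hset : ∀ n, {ω | adjPValue M (K n ω) ≤ α} = K n ⁻¹' {k | adjPValue M k ≤ α} := fun n => rfl
  simp_rw [hset]
  rcases setOf_adjPValue_le M α with h | h | ⟨q, hq, h⟩
  · exact ⟨0, by simp [h], hα⟩
  · refine ⟨1, by simp [h], ?_⟩
    have : (0 : ℝ) ∈ {k | adjPValue M k ≤ α} := h ▸ Set.mem_univ _
    rwa [Set.mem_ofPred_eq, adjPValue_of_nonpos hM le_rfl] at this
  · obtain ⟨L, hL, hLq⟩ := hK q
    rw [h]
    exact ⟨L, hL, hLq.trans hq⟩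

end Limit

end SmoothTest

theorem theorem1
    {Ω : Type*} [MeasurableSpace Ω] (P : Measure Ω) [IsProbabilityMeasure P]
    (F G : Measure ℝ) [IsProbabilityMeasure F] [IsProbabilityMeasure G]
    (hF : F ≪ volume) (hG : G ≪ volume)
    (h : ℕ → ℝ → ℝ) (hh : SmoothTest.IsOrthonormalSystem h)
    (X : ℕ → Ω → ℝ) (hX : ∀ i, Measurable (X i))
    (hindep : iIndepFun X P) (hlaw : ∀ i, P.map (X i) = F)
    (M : ℕ) (hM : 1 ≤ M) (m₀ : ℕ) (hm₀ : m₀ ≤ 1)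
    (hH0 : cdf F = cdf G) :
    (∀ k : ℝ, ∃ L : ℝ,
      Tendsto (fun n : ℕ => P.real {ω | k ≤ SmoothTest.kStat h G m₀ M n (fun i => X i ω)})
        atTop (𝓝 L) ∧
      L ≤ SmoothTest.adjPValue M k) ∧
    (∀ α ∈ Set.Icc (0 : ℝ) 1, ∃ L : ℝ,
      Tendsto (fun n : ℕ => P.real
        {ω | SmoothTest.adjPValue M (SmoothTest.kStat h G m₀ M n (fun i => X i ω)) ≤ α})
        atTop (𝓝 L) ∧
      L ≤ α) := by
  obtain rfl : F = G := Measure.eq_of_cdf F G hH0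
  have : NullSingletonClass F := ⟨fun x => hF (measure_singleton x)⟩
  have : IsProbabilityMeasure (volume.restrict (Set.Icc (0 : ℝ) 1)) := ⟨by simp⟩
  have hcdf : Measurable (cdf F) := (monotone_cdf F).measurable
  have hU : ∀ i, HasLaw (cdf F ∘ X i) (volume.restrict (Set.Icc (0 : ℝ) 1)) P := fun i =>
    ⟨(hcdf.comp (hX i)).aemeasurable, by
      rw [← Measure.map_map hcdf (hX i), hlaw i, SmoothTest.map_cdf_eq_volume_restrict F]⟩
  -- the coefficients are centred, because `h (j + 1)` is orthogonal to `h 0 = 1`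
  have hmean : ∀ j : Fin M, ∫ u in Set.Icc (0 : ℝ) 1, h (j + 1) u = 0 := fun j => by
    have horth := hh.orthonormal (j + 1) 0
    rw [if_neg (by omega)] at horth
    refine Eq.trans (setIntegral_congr_fun measurableSet_Icc fun u hu => ?_) horth
    simp [hh.zero_eq_one u hu]
  have hclt := SmoothTest.tendstoInDistribution_orthonormal_sum hU
    (hindep.comp (fun _ => cdf F) fun _ => hcdf) (f := fun j : Fin M => h (j + 1))
    (fun j => hh.memLp _) hmean
    (fun i j => by simpa [Fin.ext_iff] using hh.orthonormal (i + 1) (j + 1))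
  have hlim := SmoothTest.tendsto_measureReal_exists_le_sq hclt
  have hK : ∀ k, ∃ L, Tendsto (fun n : ℕ => P.real
      {ω | k ≤ SmoothTest.kStat h F m₀ M n (fun i => X i ω)}) atTop (𝓝 L) ∧
      L ≤ SmoothTest.adjPValue M k := by
    intro k
    obtain rfl | rfl : m₀ = 1 ∨ m₀ = 0 := by omega
    · -- the tail converges to `adjPValue M k` itself
      simp_rw [SmoothTest.le_kStat_one_iff h F hM]
      exact ⟨_, hlim k, le_rfl⟩
    -- with the empty model admitted, the statistic tends to `0` in probability
    rcases le_or_gt k 0 with hk | hk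
    · refine ⟨1, ?_, (SmoothTest.adjPValue_of_nonpos hM hk).ge⟩
      have : ∀ n, {ω | k ≤ SmoothTest.kStat h F 0 M n (fun i => X i ω)} = Set.univ := fun n =>
        Set.eq_univ_of_forall fun ω => hk.trans (SmoothTest.kStat_nonneg ..)
      simp [this]
    · refine ⟨0, ?_, SmoothTest.adjPValue_nonneg M k⟩
      refine tendsto_order.2 ⟨fun a ha => .of_forall fun n => ha.trans_le measureReal_nonneg,
        fun ε hε => ?_⟩
      -- the penalty `log n` passes any fixed level `c`, and the tail at `c` is asymptotically
      -- `adjPValue M c`, which is small for large `c`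
      obtain ⟨c, hc⟩ := ((SmoothTest.tendsto_adjPValue_atTop M).eventually (gt_mem_nhds hε)).exists
      have hlog : Tendsto (fun n : ℕ => Real.log n) atTop atTop :=
        Real.tendsto_log_atTop.comp tendsto_natCast_atTop_atTop
      filter_upwards [(hlim c).eventually (gt_mem_nhds hc), hlog.eventually_ge_atTop c,
        eventually_ge_atTop 1] with n hn hcn hn1
      refine (measureReal_mono fun ω hω => ?_).trans_lt hn
      obtain ⟨j, hj⟩ := SmoothTest.exists_log_le_of_pos_kStat_zero h F hn1 _ (hk.trans_le hω)
      exact ⟨j, hcn.trans hj⟩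
  exact ⟨hK, fun α hα => SmoothTest.exists_tendsto_adjPValue_le hM hK hα.1⟩
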